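/- Let $P\ge 1$. For $M\ge 1$ and $\mu=(\mu_1,\dots,\mu_{2P})$ with all $\mu_i\ge 0$, let $\mathbf X_1,\dots,\mathbf X_M$ be independent and identically distributed $2P$-dimensional random vectors, where each $\mathbf X_m=(X_{m,1},\dots,X_{m,2P})$ has independent components $X_{m,i}\sim\mathrm{Pois}(\mu_i)$ (with $\mathrm{Pois}(0)$ the point mass at $0$). For data $\mathbb X=(\mathbf X_m)_{m=1}^M$ let $$\mathcal L(\mathbb X;\mu_1,\dots,\mu_{2P})=\prod_{m=1}^M\prod_{i=1}^{2P}e^{-\mu_i}\frac{\mu_i^{X_{m,i}}}{X_{m,i}!}$$ be the likelihood (with $0^0=1$), let $$r=\frac{\sup\{\mathcal L(\mathbb X;\nu_1,\nu_1,\nu_2,\nu_2,\dots,\nu_P,\nu_P):\ \nu_1,\dots,\nu_P\ge 0,\ \sum_i\nu_i>0\}}{\sup\{\mathcal L(\mathbb X;\mu_1,\dots,\mu_{2P}):\ \mu_1,\dots,\mu_{2P}\ge 0,\ \sum_i\mu_i>0\}}$$ be the likelihood ratio statistic for testing $\mu_{2i-1}=\mu_{2i}$ for all $1\le i\le P$,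 and let $R=-2\log r$. (1) The distribution of $R$ depends on $M$ and $\mu$ only through the products $\mu_iM$, $1\le i\le 2P$: if $(M,\mu)$ and $(M',\mu')$ satisfy $\mu_iM=\mu'_iM'$ for all $i$, then $R$ has the same distribution under both. (2) Suppose that $\mu_{2i-1}=\mu_{2i}=\mu_i^{pair}$ with $\mu_i^{pair}\ne 0$ for all $1\le i\le P$. Then $R$ converges in distribution to $\chi^2_P$, the chi-squared distribution with $P$ degrees of freedom, as $\mu_i^{pair}M\to\infty$ for every $1\le i\le P$; here both $M\ge 1$ and the $\mu_i^{pair}$ may vary arbitrarily, as long as all $P$ products tend to infinity. -/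

import Mathlib

open MeasureTheory ProbabilityTheory Filter
open scoped NNReal

noncomputable section

namespace PoissonPairs

/-- `X 0, …, X (M - 1)` are i.i.d. random vectors with values in `ℕ^(2P)`, each having independent
components with `X m i ∼ Pois(μ i)`. (The vectors are identically distributed because the law of a
vector with independent components is determined by its marginals.) -/
structure IsSample {Ω : Type*} [MeasurableSpace Ω] (Pr : Measure Ω) {M P : ℕ}
    (μ : Fin (2 * P) → ℝ≥0) (X : Fin M → Ω → (Fin (2 * P) → ℕ)) : Prop where
  indep_vectors : iIndepFun X Pr
  indep_components : ∀ m, iIndepFun (fun i ω => X m ω i) Pr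
  law : ∀ m i, HasLaw (fun ω => X m ω i) (poissonMeasure (μ i)) Pr

/-- The likelihood of the parameter vector `μ` for the observed counts `x`. -/
def likelihood {M P : ℕ} (x : Fin M → Fin (2 * P) → ℕ) (μ : Fin (2 * P) → ℝ≥0) : ℝ :=
  ∏ m, ∏ i, (poissonMeasure (μ i)).real {x m i}

/-- The vector `(ν₁, ν₁, ν₂, ν₂, …, ν_P, ν_P)`. -/
def paired {P : ℕ} (ν : Fin P → ℝ≥0) : Fin (2 * P) → ℝ≥0 :=
  fun j => ν ⟨j / 2, by omega⟩

/-- The likelihood ratio `r`: the supremum of the likelihood over the nonzero paired parameter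
vectors, divided by its supremum over all nonzero parameter vectors. -/
def likelihoodRatio {M P : ℕ} (x : Fin M → Fin (2 * P) → ℕ) : ℝ :=
  (⨆ ν : {ν : Fin P → ℝ≥0 // 0 < ∑ i, ν i}, likelihood x (paired ν.1)) /
    (⨆ μ : {μ : Fin (2 * P) → ℝ≥0 // 0 < ∑ i, μ i}, likelihood x μ.1)

/-- The test statistic `R = -2 log r`. -/
def statR {M P : ℕ} (x : Fin M → Fin (2 * P) → ℕ) : ℝ :=
  -2 * Real.log (likelihoodRatio x)

/-- The `χ²` distribution with `k` degrees of freedom: the law of the sum of the squares of `k`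
independent standard normal random variables. -/
def chiSquared (k : ℕ) : Measure ℝ :=
  (Measure.pi fun _ : Fin k => gaussianReal 0 1).map fun z => ∑ i, z i ^ 2

instance (k : ℕ) : IsProbabilityMeasure (chiSquared k) :=
  Measure.isProbabilityMeasure_map
    (Measurable.aemeasurable (by fun_prop))

end PoissonPairs

end

/-!
For each component the likelihood `exp (-c * μ) * μ ^ s` is maximal at `μ = s / c`, where `s` is the
total count. Hence `R` is a sum over the pairs of a function `pairDeviance` of the two total counts,
which are independent with laws `Pois(μ i * M)`; this gives part (1).

The deviance is homogeneous of degree one, and by L'Hôpital's rule it equals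
`(x - y) ^ 2 / (x + y)` times a factor that tends to `1` as `(x - y) / (x + y) → 0`. For independent
`X, Y ∼ Pois(r)` and `r → ∞`, the characteristic functions show that `(X - Y) / √(2 * r)` is
asymptotically standard normal and that `X / r` and `Y / r` tend to `1`, so Slutsky's theorem gives
`pairDeviance X Y → Z ^ 2` with `Z` standard normal.
-/

namespace PoissonPairs

open scoped Topology

/-! ### Maximal likelihoods -/

/-- Twice the gap between the maximal log-likelihoods of two independent Poisson counts `x`, `y`
with free rates and with a common rate: the contribution of one pair to `statR`. Since
`Real.log 0 = 0`, the convention `0 * log 0 = 0` is built in. -/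
noncomputable def pairDeviance (x y : ℝ) : ℝ :=
  2 * (x * x.log + y * y.log - (x + y) * ((x + y) / 2).log)

lemma mul_log_mul {c : ℝ} (hc : c ≠ 0) (x : ℝ) :
    x * (c * x).log = x * c.log + x * x.log := by
  rcases eq_or_ne x 0 with rfl | hx
  · simp
  · rw [Real.log_mul hc hx, mul_add]

lemma pairDeviance_mul_mul (c x y : ℝ) :
    pairDeviance (c * x) (c * y) = c * pairDeviance x y := by
  rcases eq_or_ne c 0 with rfl | hc
  · simp [pairDeviance]
  have hmid := mul_log_mul hc ((x + y) / 2)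
  simp only [pairDeviance, ← mul_add, mul_div_assoc]
  linear_combination 2 * c * (mul_log_mul hc x + mul_log_mul hc y - 2 * hmid)

lemma exp_neg_mul_mul_pow_le {c x : ℝ} (hc : 0 < c) (hx : 0 ≤ x) (s : ℕ) :
    Real.exp (-(c * x)) * x ^ s ≤ Real.exp (s * (s / c : ℝ).log - s) := by
  rcases Nat.eq_zero_or_pos s with rfl | hs
  · simpa using mul_nonneg hc.le hx
  rcases hx.eq_or_lt with rfl | hx
  · rw [zero_pow hs.ne', mul_zero]
    positivity
  have hlog : (c * x / s).log ≤ c * x / s - 1 := Real.log_le_sub_one_of_pos (by positivity)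
  have hsplit : x.log = (s / c : ℝ).log + (c * x / s).log := by
    rw [← Real.log_mul (by positivity) (by positivity)]
    congr 1
    field_simp
  calc Real.exp (-(c * x)) * x ^ s = Real.exp (-(c * x) + s * x.log) := by
        rw [Real.exp_add, Real.exp_nat_mul, Real.exp_log hx]
    _ ≤ Real.exp (-(c * x) + s * ((s / c : ℝ).log + (c * x / s - 1))) := by
        rw [hsplit]
        gcongr
    _ = Real.exp (s * (s / c : ℝ).log - s) := by
        congr 1
        field_simp
        ring

lemma exp_neg_mul_div_mul_pow {c : ℝ} (hc : 0 < c) (s : ℕ) :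
    Real.exp (-(c * (s / c))) * (s / c) ^ s = Real.exp (s * (s / c : ℝ).log - s) := by
  rcases Nat.eq_zero_or_pos s with rfl | hs
  · simp
  · rw [mul_div_cancel₀ _ hc.ne', sub_eq_neg_add, Real.exp_add, Real.exp_nat_mul,
      Real.exp_log (by positivity)]

lemma ciSup_sum_pos_eq_of_forall_le {ι : Type*} [Fintype ι] [Nonempty ι] {F : (ι → ℝ≥0) → ℝ}
    (hF : Continuous F) {v : ι → ℝ≥0} (hv : ∀ u, F u ≤ F v) :
    (⨆ u : {u : ι → ℝ≥0 // 0 < ∑ i, u i}, F u.1) = F v := by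
  have sum_pos (ε : ℝ≥0) (hε : 0 < ε) : 0 < ∑ i, (v i + ε) :=
    Finset.sum_pos (fun i _ => by positivity) Finset.univ_nonempty
  have : Nonempty {u : ι → ℝ≥0 // 0 < ∑ i, u i} := ⟨⟨fun i => v i + 1, sum_pos 1 one_pos⟩⟩
  refine le_antisymm (ciSup_le fun u => hv u) ?_
  have hlim : Tendsto (fun ε : ℝ≥0 => F fun i => v i + ε) (𝓝[>] 0) (𝓝 (F v)) := by
    have : Continuous fun ε : ℝ≥0 => F fun i => v i + ε := by fun_prop
    simpa using (this.tendsto 0).mono_left nhdsWithin_le_nhds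
  refine le_of_tendsto hlim ?_
  filter_upwards [self_mem_nhdsWithin] with ε hε
  exact le_ciSup (f := fun u : {u : ι → ℝ≥0 // 0 < ∑ i, u i} => F u.1)
    ⟨F v, Set.forall_mem_range.2 fun u => hv u⟩ ⟨fun i => v i + ε, sum_pos ε hε⟩

lemma ciSup_mul_prod_exp_neg_mul_mul_pow {ι : Type*} [Fintype ι] [Nonempty ι] {c C : ℝ}
    (hc : 0 < c) (hC : 0 ≤ C) (s : ι → ℕ) :
    (⨆ μ : {μ : ι → ℝ≥0 // 0 < ∑ i, μ i},
      C * ∏ i, (Real.exp (-(c * μ.1 i)) * (μ.1 i : ℝ) ^ s i)) =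
      C * Real.exp (∑ i, (s i * (s i / c : ℝ).log - s i)) := by
  have hmax : C * ∏ i, (Real.exp (-(c * (s i / c))) * (s i / c) ^ s i) =
      C * Real.exp (∑ i, (s i * (s i / c : ℝ).log - s i)) := by
    simp only [exp_neg_mul_div_mul_pow hc, Real.exp_sum]
  rw [← hmax]
  refine ciSup_sum_pos_eq_of_forall_le
    (F := fun μ => C * ∏ i, (Real.exp (-(c * μ i)) * (μ i : ℝ) ^ s i))
    (v := fun i => ⟨s i / c, by positivity⟩) (by fun_prop) fun μ => ?_
  refine mul_le_mul_of_nonneg_left (Finset.prod_le_prod (fun i _ => by positivity) fun i _ => ?_) hC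
  exact (exp_neg_mul_mul_pow_le hc (μ i).2 (s i)).trans_eq (exp_neg_mul_div_mul_pow hc (s i)).symm

/-- The bijection between `Fin P × Fin 2` and `Fin (2 * P)` that sends `(p, j)` to `2 * p + j`, so
that the images of `(p, 0)` and `(p, 1)` are the two components of the `p`-th pair. -/
def pairEquiv (P : ℕ) : Fin P × Fin 2 ≃ Fin (2 * P) :=
  finProdFinEquiv.trans (finCongr (mul_comm P 2))

lemma paired_pairEquiv {P : ℕ} (ν : Fin P → ℝ≥0) (p : Fin P) (j : Fin 2) :
    paired ν (pairEquiv P (p, j)) = ν p := by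
  have : ((j : ℕ) + 2 * p) / 2 = p := by omega
  simp [paired, pairEquiv, this]

/-- The componentwise sums of the observed counts. -/
def total {M P : ℕ} (x : Fin M → Fin (2 * P) → ℕ) : Fin (2 * P) → ℕ := ∑ m, x m

lemma likelihood_eq {M P : ℕ} (x : Fin M → Fin (2 * P) → ℕ) (μ : Fin (2 * P) → ℝ≥0) :
    likelihood x μ = (∏ m, ∏ i, ((x m i).factorial : ℝ)⁻¹) *
      ∏ i, (Real.exp (-(M * μ i)) * (μ i : ℝ) ^ total x i) := by
  simp only [likelihood, poissonMeasure_real_singleton, div_eq_mul_inv, Finset.prod_mul_distrib]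
  rw [mul_comm, Finset.prod_const, Finset.prod_comm (f := fun m i => (μ i : ℝ) ^ x m i),
    ← Finset.prod_pow]
  simp only [← Real.exp_nat_mul, Finset.prod_pow_eq_pow_sum, total, Finset.sum_apply,
    Finset.card_univ, Fintype.card_fin, mul_neg]

lemma likelihood_paired {M P : ℕ} (x : Fin M → Fin (2 * P) → ℕ) (ν : Fin P → ℝ≥0) :
    likelihood x (paired ν) = (∏ m, ∏ i, ((x m i).factorial : ℝ)⁻¹) *
      ∏ p, (Real.exp (-(2 * M * ν p)) * (ν p : ℝ) ^ ∑ j, total x (pairEquiv P (p, j))) := by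
  rw [likelihood_eq, ← (pairEquiv P).prod_comp, Fintype.prod_prod_type]
  congr! 2 with p
  simp only [paired_pairEquiv, Finset.prod_mul_distrib, Finset.prod_pow_eq_pow_sum,
    Finset.prod_const, Finset.card_univ, Fintype.card_fin, ← Real.exp_nat_mul]
  congr 2
  push_cast
  ring

theorem statR_eq_sum_pairDeviance {M P : ℕ} (hM : 1 ≤ M) (hP : 1 ≤ P)
    (x : Fin M → Fin (2 * P) → ℕ) :
    statR x = ∑ p, pairDeviance (total x (pairEquiv P (p, 0))) (total x (pairEquiv P (p, 1))) := by
  have : NeZero P := ⟨by omega⟩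
  have : NeZero (2 * P) := ⟨by omega⟩
  have hM' : (0 : ℝ) < M := by exact_mod_cast hM
  have hC : 0 < ∏ m, ∏ i, ((x m i).factorial : ℝ)⁻¹ := by positivity
  have hterm (a b : ℝ) : 2 * (a * (a / M).log - a + (b * (b / M).log - b) -
      ((a + b) * ((a + b) / (2 * M)).log - (a + b))) = pairDeviance a b := calc
    _ = M * pairDeviance (a / M) (b / M) := by
      rw [pairDeviance, ← add_div, div_div, mul_comm (M : ℝ) 2]
      field_simp
      ring
    _ = pairDeviance a b := by
      rw [← pairDeviance_mul_mul, mul_div_cancel₀ _ hM'.ne', mul_div_cancel₀ _ hM'.ne']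
  simp only [statR, likelihoodRatio, likelihood_paired]
  simp only [likelihood_eq]
  rw [ciSup_mul_prod_exp_neg_mul_mul_pow (by positivity) hC.le,
    ciSup_mul_prod_exp_neg_mul_mul_pow hM' hC.le, mul_div_mul_left _ _ hC.ne', ← Real.exp_sub,
    Real.log_exp, ← (pairEquiv P).sum_comp (fun i => (total x i : ℝ) * _ - _),
    Fintype.sum_prod_type, ← Finset.sum_sub_distrib, Finset.mul_sum]
  refine Finset.sum_congr rfl fun p _ => ?_
  rw [← hterm, Fin.sum_univ_two, Fin.sum_univ_two]
  push_cast
  ring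

/-! ### The law of the test statistic -/

lemma pi_conv_pi {ι E : Type*} [Fintype ι] [AddMonoid E] [MeasurableSpace E] [MeasurableAdd₂ E]
    (a b : ι → Measure E) [∀ i, IsFiniteMeasure (a i)] [∀ i, IsFiniteMeasure (b i)] :
    (Measure.pi a).conv (Measure.pi b) = Measure.pi fun i => (a i).conv (b i) := by
  have hprod := measurePreserving_arrowProdEquivProdArrow E E ι a b
  rw [Measure.conv, ← hprod.map_eq, Measure.map_map (by fun_prop) hprod.measurable]
  exact Measure.pi_map_pi (μ := fun i => (a i).prod (b i)) (f := fun _ (x : E × E) => x.1 + x.2)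
    fun i => by fun_prop

lemma hasLaw_sum_pi_poissonMeasure {Ω ι κ : Type*} [MeasurableSpace Ω] {Pr : Measure Ω}
    [IsProbabilityMeasure Pr] [Fintype ι] {μ : ι → ℝ≥0} {X : κ → Ω → ι → ℕ}
    (hX : iIndepFun X Pr) (hlaw : ∀ m, HasLaw (X m) (Measure.pi fun i => poissonMeasure (μ i)) Pr)
    {s : Finset κ} (hs : s.Nonempty) :
    HasLaw (∑ m ∈ s, X m) (Measure.pi fun i => poissonMeasure (μ i * s.card)) Pr := by
  induction hs using Finset.Nonempty.cons_induction with
  | singleton m => simpa using hlaw m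
  | cons m s hm _ ih =>
    have hindep := hX.indepFun_finsetSum_of_notMem₀ (fun m => (hlaw m).aemeasurable) hm
    have hadd := hindep.hasLaw_add ih (hlaw m)
    rw [pi_conv_pi] at hadd
    simpa [poissonMeasure_conv_poissonMeasure, mul_add, Finset.sum_cons, add_comm] using hadd

lemma IsSample.hasLaw_total {Ω : Type*} [MeasurableSpace Ω] {Pr : Measure Ω}
    [IsProbabilityMeasure Pr] {M P : ℕ} {μ : Fin (2 * P) → ℝ≥0}
    {X : Fin M → Ω → (Fin (2 * P) → ℕ)} (hM : 1 ≤ M) (h : IsSample Pr μ X) :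
    HasLaw (fun ω => total fun m => X m ω)
      (Measure.pi fun i => poissonMeasure (μ i * M)) Pr := by
  have hsum := hasLaw_sum_pi_poissonMeasure h.indep_vectors
    (fun m => (h.indep_components m).hasLaw_pi (h.law m))
    (Finset.univ_nonempty_iff.2 ⟨⟨0, hM⟩⟩)
  simpa [Finset.sum_fn, total] using hsum

lemma measurePreserving_curry_equiv {ι κ α E : Type*} [Fintype ι] [Fintype κ] [Fintype α]
    [MeasurableSpace E] (e : ι × κ ≃ α) (μ : α → Measure E) [∀ i, IsProbabilityMeasure (μ i)] :
    MeasurePreserving (fun s i j => s (e (i, j))) (Measure.pi μ)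
      (Measure.pi fun i => Measure.pi fun j => μ (e (i, j))) := by
  have hcurry := Measure.infinitePi_map_curry fun i j => μ (e (i, j))
  have hcongr := Measure.infinitePi_map_piCongrLeft μ e
  simp only [Measure.infinitePi_eq_pi] at hcurry hcongr
  refine ⟨by fun_prop, ?_⟩
  rw [← hcurry, ← hcongr, Measure.map_map (by fun_prop) (by fun_prop)]
  congr 1
  ext s i j
  exact Equiv.piCongrLeft_apply_apply ..

/-- The law of the deviance of a pair of independent Poisson variables with rates `r 0`, `r 1`. -/
noncomputable def pairDevianceLaw (r : Fin 2 → ℝ≥0) : ProbabilityMeasure ℝ :=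
  ⟨(Measure.pi fun j => poissonMeasure (r j)).map fun y => pairDeviance (y 0) (y 1),
    Measure.isProbabilityMeasure_map .of_discrete⟩

lemma measurePreserving_pairDeviance (r : Fin 2 → ℝ≥0) :
    MeasurePreserving (fun y : Fin 2 → ℕ => pairDeviance (y 0) (y 1))
      (Measure.pi fun j => poissonMeasure (r j)) (pairDevianceLaw r) :=
  ⟨.of_discrete, rfl⟩

/-- The law of the square of a standard normal random variable. -/
noncomputable def sqGaussian : ProbabilityMeasure ℝ :=
  ⟨(gaussianReal 0 1).map fun z => z ^ 2, Measure.isProbabilityMeasure_map (by fun_prop)⟩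

/-- The law of the sum of independent real random variables with laws `ρ i`. -/
noncomputable def sumLaw {ι : Type*} [Fintype ι] (ρ : ι → ProbabilityMeasure ℝ) :
    ProbabilityMeasure ℝ :=
  (ProbabilityMeasure.pi ρ).map (f := fun y => ∑ i, y i) (Measurable.aemeasurable (by fun_prop))

lemma continuous_sumLaw {ι : Type*} [Fintype ι] : Continuous (sumLaw (ι := ι)) :=
  (ProbabilityMeasure.continuous_map (by fun_prop)).comp ProbabilityMeasure.continuous_pi

lemma measurePreserving_sum_pi {ι E : Type*} [Fintype ι] [MeasurableSpace E] {ν : ι → Measure E}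
    [∀ i, SigmaFinite (ν i)] {ρ : ι → ProbabilityMeasure ℝ} {f : ι → E → ℝ}
    (hf : ∀ i, MeasurePreserving (f i) (ν i) (ρ i)) :
    MeasurePreserving (fun y => ∑ i, f i (y i)) (Measure.pi ν) (sumLaw ρ) := by
  have hpi := measurePreserving_pi ν (fun i => (ρ i : Measure ℝ)) hf
  have hsum : MeasurePreserving (fun y : ι → ℝ => ∑ i, y i)
      (Measure.pi fun i => (ρ i : Measure ℝ)) (sumLaw ρ) := ⟨by fun_prop, rfl⟩
  exact hsum.comp hpi

lemma sumLaw_sqGaussian (P : ℕ) :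
    (sumLaw fun _ : Fin P => sqGaussian : Measure ℝ) = chiSquared P :=
  (measurePreserving_sum_pi (ν := fun _ => gaussianReal 0 1) (f := fun _ z => z ^ 2)
    fun _ => ⟨by fun_prop, rfl⟩).map_eq.symm

theorem IsSample.hasLaw_statR {Ω : Type*} [MeasurableSpace Ω] {Pr : Measure Ω}
    [IsProbabilityMeasure Pr] {M P : ℕ} {μ : Fin (2 * P) → ℝ≥0}
    {X : Fin M → Ω → (Fin (2 * P) → ℕ)} (hM : 1 ≤ M) (hP : 1 ≤ P) (h : IsSample Pr μ X) :
    HasLaw (fun ω => statR fun m => X m ω)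
      (sumLaw fun p => pairDevianceLaw fun j => μ (pairEquiv P (p, j)) * M) Pr := by
  have hsum := (measurePreserving_sum_pi fun p => measurePreserving_pairDeviance fun j =>
    μ (pairEquiv P (p, j)) * M).comp
    (measurePreserving_curry_equiv (pairEquiv P) fun i => poissonMeasure (μ i * M))
  simpa only [statR_eq_sum_pairDeviance hM hP] using! hsum.comp_hasLaw (h.hasLaw_total hM)

/-! ### The deviance near the diagonal -/

lemma pairDeviance_one_add_one_sub (t : ℝ) : pairDeviance (1 + t) (1 - t) =
    2 * ((1 + t) * (1 + t).log + (1 - t) * (1 - t).log) := by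
  norm_num [pairDeviance]

lemma tendsto_pairDeviance_div_sq :
    Tendsto (fun t => pairDeviance (1 + t) (1 - t) / (2 * t ^ 2)) (𝓝[≠] 0) (𝓝 1) := by
  have hlog : HasDerivAt (fun t : ℝ => (1 + t).log - (1 - t).log) 2 0 := by
    have h := ((hasDerivAt_id (0 : ℝ)).const_add 1).log (by norm_num)
    have h' := ((hasDerivAt_id (0 : ℝ)).const_sub 1).log (by norm_num)
    exact (h.sub h').congr_deriv (by norm_num)
  have hslope : Tendsto (fun t : ℝ => 2 * ((1 + t).log - (1 - t).log) / (2 * (2 * t)))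
      (𝓝[≠] 0) (𝓝 1) := by
    convert hlog.tendsto_slope_zero.div_const 2 using 2 with t
    · simp only [zero_add, add_zero, Real.log_one, sub_zero, sub_self, smul_eq_mul]
      ring
    · norm_num
  have hnear : ∀ᶠ t : ℝ in 𝓝[≠] 0, 0 < 1 + t ∧ 0 < 1 - t := by
    filter_upwards [mem_nhdsWithin_of_mem_nhds (Ioo_mem_nhds neg_one_lt_zero one_pos)] with t ht
    constructor <;> linarith [ht.1, ht.2]
  simp only [pairDeviance_one_add_one_sub]
  refine HasDerivAt.lhopital_zero_nhdsNE (hnear.mono fun t ht => ?_)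
    (Eventually.of_forall fun t => by simpa using (hasDerivAt_pow 2 t).const_mul 2)
    (eventually_mem_nhdsWithin.mono fun t ht => by simpa using ht)
    (tendsto_nhdsWithin_of_tendsto_nhds ?_) (tendsto_nhdsWithin_of_tendsto_nhds ?_) hslope
  · have h := (Real.hasDerivAt_mul_log ht.1.ne').comp_const_add 1 t
    have h' := (Real.hasDerivAt_mul_log ht.2.ne').comp_const_sub 1 t
    exact ((h.add h').const_mul 2).congr_deriv (by ring)
  · have : ContinuousAt (fun t : ℝ => 2 * ((1 + t) * (1 + t).log + (1 - t) * (1 - t).log)) 0 := by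
      fun_prop (disch := norm_num)
    simpa [ContinuousAt] using this
  · have : Continuous fun t : ℝ => 2 * t ^ 2 := by fun_prop
    simpa using this.tendsto 0

/-- The factor by which `pairDeviance x y` differs from `(x - y) ^ 2 / (x + y)`, as a function of
`t = (x - y) / (x + y)`, with the removable singularity at `0` filled in. -/
noncomputable def devianceFactor : ℝ → ℝ :=
  Function.update (fun t => pairDeviance (1 + t) (1 - t) / (2 * t ^ 2)) 0 1

lemma continuousAt_devianceFactor_zero : ContinuousAt devianceFactor 0 :=
  continuousAt_update_same.2 tendsto_pairDeviance_div_sq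

lemma pairDeviance_eq_mul_devianceFactor (x y : ℝ) :
    pairDeviance x y = (x - y) ^ 2 / (x + y) * devianceFactor ((x - y) / (x + y)) := by
  rcases eq_or_ne (x + y) 0 with hxy | hxy
  · obtain rfl := eq_neg_of_add_eq_zero_left hxy
    simp [pairDeviance]
  rcases eq_or_ne x y with rfl | hne
  · simp only [pairDeviance, add_self_div_two, sub_self, ne_eq, OfNat.ofNat_ne_zero,
      not_false_eq_true, zero_pow, zero_div, zero_mul]
    ring
  have ht : (x - y) / (x + y) ≠ 0 := div_ne_zero (sub_ne_zero.2 hne) hxy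
  have hx : x = (x + y) / 2 * (1 + (x - y) / (x + y)) := by field_simp; ring
  have hy : y = (x + y) / 2 * (1 - (x - y) / (x + y)) := by field_simp; ring
  calc pairDeviance x y
      = (x + y) / 2 * pairDeviance (1 + (x - y) / (x + y)) (1 - (x - y) / (x + y)) := by
        rw [← pairDeviance_mul_mul, ← hx, ← hy]
    _ = _ := by
        rw [devianceFactor, Function.update_of_ne ht]
        have := sub_ne_zero.2 hne
        field_simp

lemma measurable_devianceFactor : Measurable devianceFactor := by
  classical
  have : Measurable fun t => pairDeviance (1 + t) (1 - t) / (2 * t ^ 2) := by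
    unfold pairDeviance
    fun_prop
  rw [devianceFactor, ← Set.piecewise_singleton 0 (fun _ => (1 : ℝ))]
  exact Measurable.piecewise (measurableSet_singleton 0) measurable_const this

/-- The ratio of `pairDeviance (r * x) (r * y)` to the squared normalized difference
`(r * x - r * y) ^ 2 / (2 * r)`; it does not depend on `r`. -/
noncomputable def devianceRatio (x : ℝ × ℝ) : ℝ :=
  2 / (x.1 + x.2) * devianceFactor ((x.1 - x.2) / (x.1 + x.2))

lemma measurable_devianceRatio : Measurable devianceRatio :=
  (by fun_prop : Measurable fun x : ℝ × ℝ => 2 / (x.1 + x.2)).mul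
    (measurable_devianceFactor.comp (by fun_prop))

lemma devianceRatio_one_one : devianceRatio (1, 1) = 1 := by
  norm_num [devianceRatio, devianceFactor]

lemma continuousAt_devianceRatio : ContinuousAt devianceRatio (1, 1) := by
  have harg : ContinuousAt (fun x : ℝ × ℝ => (x.1 - x.2) / (x.1 + x.2)) (1, 1) := by
    fun_prop (disch := norm_num)
  have hfactor : ContinuousAt devianceFactor (((1 : ℝ) - 1) / (1 + 1)) := by
    rw [sub_self, zero_div]
    exact continuousAt_devianceFactor_zero
  exact (continuousAt_const.div (by fun_prop) (by norm_num)).mul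
    (ContinuousAt.comp (f := fun x : ℝ × ℝ => (x.1 - x.2) / (x.1 + x.2)) hfactor harg)

lemma pairDeviance_eq_mul_devianceRatio {r : ℝ} (hr : 0 < r) (x y : ℝ) :
    pairDeviance x y =
      ((√(2 * r))⁻¹ * (x - y)) ^ 2 * devianceRatio (r⁻¹ * x, r⁻¹ * y) := by
  have hr' : r⁻¹ ≠ 0 := inv_ne_zero hr.ne'
  rw [devianceRatio, pairDeviance_eq_mul_devianceFactor, mul_pow, inv_pow,
    Real.sq_sqrt (by positivity)]
  simp only [← mul_add, ← mul_sub, mul_div_mul_left _ _ hr']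
  field_simp

/-! ### Convergence of the deviance of a Poisson pair -/

lemma tendstoInMeasure_comp_of_tendstoInDistribution_const {ι Ω Ω' E F : Type*}
    [MeasurableSpace Ω] [MeasurableSpace Ω'] {Pr : Measure Ω} [IsProbabilityMeasure Pr]
    {Pr' : Measure Ω'} [IsProbabilityMeasure Pr'] [PseudoEMetricSpace E] [MeasurableSpace E]
    [BorelSpace E] [PseudoEMetricSpace F] {l : Filter ι} {X : ι → Ω → E} {c : E}
    (hX : TendstoInDistribution X l (fun _ => c) (fun _ => Pr) Pr') {g : E → F}
    (hg : ContinuousAt g c) :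
    TendstoInMeasure Pr (fun i ω => g (X i ω)) l fun _ => g c := by
  intro ε hε
  obtain ⟨U, hU, hU_open, hcU⟩ :=
    mem_nhds_iff.1 (hg.eventually_mem (Metric.eball_mem_nhds (g c) hε))
  have hlimsup : limsup (fun i => Pr.map (X i) Uᶜ) l ≤ 0 := by
    refine (ProbabilityMeasure.limsup_measure_closed_le_of_tendsto hX.tendsto
      hU_open.isClosed_compl).trans_eq ?_
    simp [Measure.dirac_apply' _ hU_open.measurableSet.compl, hcU]
  refine tendsto_of_le_liminf_of_limsup_le zero_le ((limsup_le_limsup ?_).trans hlimsup)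
  refine Eventually.of_forall fun i => ?_
  beta_reduce
  rw [Measure.map_apply_of_aemeasurable (hX.forall_aemeasurable i) hU_open.measurableSet.compl]
  exact measure_mono fun ω hω hωU => (Metric.mem_eball.1 (hU hωU)).not_ge hω

section Poisson

/-- The Poisson distribution of rate `r` as a measure on `ℝ`. -/
noncomputable abbrev poissonReal (r : ℝ≥0) : Measure ℝ := (poissonMeasure r).map Nat.cast

variable {Ω : Type*} [MeasurableSpace Ω] {Pr : Measure Ω}

lemma charFun_map_const_mul_poisson {X : Ω → ℝ} {r : ℝ≥0} (hX : HasLaw X (poissonReal r) Pr)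
    (c t : ℝ) : charFun (Pr.map fun ω => c * X ω) t =
      Complex.exp (r * (Complex.exp ((c * t : ℝ) * Complex.I) - 1)) := by
  rw [charFun_map_mul_comp hX.aemeasurable, hX.map_eq, charFun_map_cast_poissonMeasure]

lemma tendsto_mul_exp_inv_mul_sub_one (t : ℝ) :
    Tendsto (fun r : ℝ => (r : ℂ) * (Complex.exp ((r⁻¹ * t : ℝ) * Complex.I) - 1)) atTop
      (𝓝 (t * Complex.I)) := by
  have hderiv : HasDerivAt (fun x : ℝ => Complex.exp ((x * t : ℝ) * Complex.I)) (t * Complex.I)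
      0 := by
    have h : HasDerivAt (fun x : ℝ => ((x * t : ℝ) : ℂ) * Complex.I) (t * Complex.I) 0 := by
      simpa using (((hasDerivAt_id (0 : ℝ)).mul_const t).ofReal_comp).mul_const Complex.I
    simpa using h.cexp
  simpa [Function.comp_def] using hderiv.tendsto_slope_zero_right.comp tendsto_inv_atTop_nhdsGT_zero

lemma tendsto_two_mul_cos_inv_sqrt_mul_sub_one (t : ℝ) :
    Tendsto (fun r : ℝ => 2 * r * (Real.cos ((√(2 * r))⁻¹ * t) - 1)) atTop (𝓝 (-t ^ 2 / 2)) := by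
  have hcos (x : ℝ) : Real.cos x - 1 = -(x ^ 2 / 2) * Real.sinc (x / 2) ^ 2 := by
    rcases eq_or_ne x 0 with rfl | hx
    · simp
    rw [Real.sinc_of_ne_zero (by positivity), div_pow, Real.sin_sq_eq_half_sub, mul_div_cancel₀]
    · field_simp; ring
    · exact two_ne_zero
  have harg : Tendsto (fun r : ℝ => (√(2 * r))⁻¹ * t / 2) atTop (𝓝 0) := by
    have := tendsto_inv_atTop_zero.comp (Real.tendsto_sqrt_atTop.comp
      (tendsto_id.const_mul_atTop (two_pos (α := ℝ))))
    simpa using (this.mul_const t).div_const 2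
  have hsinc : Tendsto (fun r : ℝ => -t ^ 2 / 2 * Real.sinc ((√(2 * r))⁻¹ * t / 2) ^ 2) atTop
      (𝓝 (-t ^ 2 / 2)) := by
    simpa using (((Real.continuous_sinc.tendsto 0).comp harg).pow 2).const_mul (-t ^ 2 / 2)
  refine hsinc.congr' ?_
  filter_upwards [eventually_gt_atTop 0] with r hr
  rw [hcos, mul_pow, inv_pow, Real.sq_sqrt (by positivity)]
  field_simp

variable [IsProbabilityMeasure Pr]

lemma charFun_map_const_mul_sub_poisson {X Y : Ω → ℝ} {r : ℝ≥0}
    (hX : HasLaw X (poissonReal r) Pr) (hY : HasLaw Y (poissonReal r) Pr)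
    (hXY : IndepFun X Y Pr) (c t : ℝ) :
    charFun (Pr.map fun ω => c * (X ω - Y ω)) t =
      Complex.exp ((2 * r * (Real.cos (c * t) - 1) : ℝ)) := by
  have hsum : (fun ω => c * (X ω - Y ω)) = (fun ω => c * X ω) + fun ω => -c * Y ω := by
    ext ω
    simp only [Pi.add_apply]
    ring
  have hindep : IndepFun (fun ω => c * X ω) (fun ω => -c * Y ω) Pr :=
    hXY.comp (measurable_const_mul c) (measurable_const_mul (-c))
  rw [hsum, hindep.charFun_map_add_eq_mul (hX.aemeasurable.const_mul c)
    (hY.aemeasurable.const_mul (-c)), Pi.mul_apply, charFun_map_const_mul_poisson hX,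
    charFun_map_const_mul_poisson hY, ← Complex.exp_add]
  congr 1
  push_cast [Complex.cos]
  ring_nf

variable {r : ℕ → ℝ≥0} {X Y : ℕ → Ω → ℝ}

lemma tendstoInDistribution_inv_mul_poisson (hX : ∀ n, HasLaw (X n) (poissonReal (r n)) Pr)
    (hr : Tendsto r atTop atTop) :
    TendstoInDistribution (fun n ω => (r n : ℝ)⁻¹ * X n ω) atTop (fun _ => 1) (fun _ => Pr) Pr := by
  refine ⟨fun n => (hX n).aemeasurable.const_mul _, aemeasurable_const,
    ProbabilityMeasure.tendsto_iff_tendsto_charFun.2 fun t => ?_⟩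
  have hlim := (Complex.continuous_exp.tendsto _).comp
    ((tendsto_mul_exp_inv_mul_sub_one t).comp (NNReal.tendsto_coe_atTop.2 hr))
  simpa [Function.comp_def, charFun_map_const_mul_poisson (hX _), charFun_dirac] using hlim

lemma tendstoInDistribution_inv_sqrt_mul_poisson_sub
    (hX : ∀ n, HasLaw (X n) (poissonReal (r n)) Pr)
    (hY : ∀ n, HasLaw (Y n) (poissonReal (r n)) Pr) (hXY : ∀ n, IndepFun (X n) (Y n) Pr)
    (hr : Tendsto r atTop atTop) :
    TendstoInDistribution (fun n ω => (√(2 * r n))⁻¹ * (X n ω - Y n ω)) atTop id (fun _ => Pr)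
      (gaussianReal 0 1) := by
  refine ⟨fun n => ((hX n).aemeasurable.sub (hY n).aemeasurable).const_mul _, aemeasurable_id,
    ProbabilityMeasure.tendsto_iff_tendsto_charFun.2 fun t => ?_⟩
  have hlim := (Complex.continuous_exp.tendsto _).comp ((Complex.continuous_ofReal.tendsto _).comp
    ((tendsto_two_mul_cos_inv_sqrt_mul_sub_one t).comp (NNReal.tendsto_coe_atTop.2 hr)))
  simp only [ProbabilityMeasure.coe_mk, Measure.map_id, charFun_gaussianReal,
    charFun_map_const_mul_sub_poisson (hX _) (hY _) (hXY _)]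
  convert! hlim using 3
  push_cast
  ring

theorem tendstoInDistribution_pairDeviance
    (hX : ∀ n, HasLaw (X n) (poissonReal (r n)) Pr)
    (hY : ∀ n, HasLaw (Y n) (poissonReal (r n)) Pr) (hXY : ∀ n, IndepFun (X n) (Y n) Pr)
    (hr₀ : ∀ n, r n ≠ 0) (hr : Tendsto r atTop atTop) :
    TendstoInDistribution (fun n ω => pairDeviance (X n ω) (Y n ω)) atTop (fun z => z ^ 2)
      (fun _ => Pr) (gaussianReal 0 1) := by
  have hmean : TendstoInDistribution (fun n ω => ((r n : ℝ)⁻¹ * X n ω, (r n : ℝ)⁻¹ * Y n ω)) atTop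
      (fun _ => (1, 1)) (fun _ => Pr) Pr := by
    have hY' := tendstoInDistribution_inv_mul_poisson hY hr
    exact (tendstoInDistribution_inv_mul_poisson hX hr).prodMk_of_tendstoInMeasure_const _ _ _
      (tendstoInMeasure_comp_of_tendstoInDistribution_const hY' continuousAt_id)
      hY'.forall_aemeasurable
  have hratio : TendstoInMeasure Pr
      (fun n ω => devianceRatio ((r n : ℝ)⁻¹ * X n ω, (r n : ℝ)⁻¹ * Y n ω)) atTop fun _ => 1 := by
    simpa only [devianceRatio_one_one] using
      tendstoInMeasure_comp_of_tendstoInDistribution_const hmean continuousAt_devianceRatio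
  have hslutsky := (tendstoInDistribution_inv_sqrt_mul_poisson_sub hX hY hXY hr)
    |>.continuous_comp_prodMk_of_tendstoInMeasure_const (g := fun x : ℝ × ℝ => x.1 ^ 2 * x.2)
      (by fun_prop) hratio fun n =>
        measurable_devianceRatio.comp_aemeasurable (hmean.forall_aemeasurable n)
  have hr' (n : ℕ) : (0 : ℝ) < r n := by exact_mod_cast (hr₀ n).pos
  simpa only [← pairDeviance_eq_mul_devianceRatio (hr' _), mul_one, id_eq] using hslutsky

end Poisson

theorem tendsto_pairDevianceLaw :
    Tendsto (fun r => pairDevianceLaw fun _ => r) atTop (𝓝 sqGaussian) := by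
  refine tendsto_of_seq_tendsto fun u hu => ?_
  set r : ℕ → ℝ≥0 := fun n => max (u n) 1
  have hr : Tendsto r atTop atTop := tendsto_atTop_mono (fun n => le_max_left _ _) hu
  have hur : r =ᶠ[atTop] u := (hu.eventually_ge_atTop 1).mono fun n => max_eq_left
  obtain ⟨Ω, _, Pr, N, -, hN, -, _⟩ := exists_hasLaw_indepFun (fun _ : ℕ => Fin 2 → ℕ)
    fun n => Measure.pi fun _ => poissonMeasure (r n)
  have hcoord (n : ℕ) (j : Fin 2) : HasLaw (fun ω => N n ω j) (poissonMeasure (r n)) Pr :=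
    (measurePreserving_eval (fun _ => poissonMeasure (r n)) j).comp_hasLaw (hN n)
  have hcast (n : ℕ) (j : Fin 2) : HasLaw (fun ω => (N n ω j : ℝ)) (poissonReal (r n)) Pr :=
    HasLaw.comp (Y := Nat.cast) ⟨.of_discrete, rfl⟩ (hcoord n j)
  have hindep (n : ℕ) : IndepFun (fun ω => (N n ω 0 : ℝ)) (fun ω => (N n ω 1 : ℝ)) Pr :=
    (((iIndepFun_iff_hasLaw_pi_pi (hcoord n)).2 (hN n)).indepFun zero_ne_one).comp
      (φ := Nat.cast) (ψ := Nat.cast) .of_discrete .of_discrete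
  have hlim := (tendstoInDistribution_pairDeviance (fun n => hcast n 0) (fun n => hcast n 1) hindep
    (fun n => (lt_max_of_lt_right one_pos).ne') hr).tendsto
  refine hlim.congr' (hur.mono fun n hn => Subtype.ext ?_)
  simpa only [Function.comp_apply, ← hn] using!
    ((measurePreserving_pairDeviance fun _ => r n).comp_hasLaw (hN n)).map_eq

end PoissonPairs

open PoissonPairs in
theorem theorem3p2 (P : ℕ) (hP : 1 ≤ P) :
    -- the law of `R` depends on `M` and the `μ i` only through the products `μ i * M`
    (∀ {Ω : Type*} {Ω' : Type*} [MeasurableSpace Ω] [MeasurableSpace Ω']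
        (Pr : Measure Ω) (Pr' : Measure Ω') [IsProbabilityMeasure Pr] [IsProbabilityMeasure Pr']
        (M M' : ℕ) (_ : 1 ≤ M) (_ : 1 ≤ M') (μ μ' : Fin (2 * P) → ℝ≥0)
        (X : Fin M → Ω → (Fin (2 * P) → ℕ)) (X' : Fin M' → Ω' → (Fin (2 * P) → ℕ))
        (_ : IsSample Pr μ X) (_ : IsSample Pr' μ' X')
        (_ : ∀ i, μ i * M = μ' i * M'),
        IdentDistrib (fun ω => statR fun m => X m ω) (fun ω => statR fun m => X' m ω) Pr Pr') ∧
    -- under the null hypothesis, `R → χ²_P` in distribution as all `ν i * M → ∞`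
    (∀ {ι : Type*} (l : Filter ι) {Ω : ι → Type*} [∀ n, MeasurableSpace (Ω n)]
        (Pr : ∀ n, Measure (Ω n)) [∀ n, IsProbabilityMeasure (Pr n)]
        (M : ι → ℕ) (_ : ∀ n, 1 ≤ M n) (ν : ι → Fin P → ℝ≥0) (_ : ∀ n i, ν n i ≠ 0)
        (X : ∀ n, Fin (M n) → Ω n → (Fin (2 * P) → ℕ))
        (_ : ∀ n, IsSample (Pr n) (paired (ν n)) (X n))
        (_ : ∀ i, Tendsto (fun n => ν n i * M n) l atTop),
        TendstoInDistribution (fun n ω => statR fun m => X n m ω) l id Pr (chiSquared P)) := by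
  constructor
  · intro Ω Ω' _ _ Pr Pr' _ _ M M' hM hM' μ μ' X X' hX hX' h
    have hlaw := hX.hasLaw_statR hM hP
    simp only [h] at hlaw
    exact hlaw.identDistrib (hX'.hasLaw_statR hM' hP)
  · intro ι l Ω _ Pr _ M hM ν _ X hX hlim
    have hlaw n := (hX n).hasLaw_statR (hM n) hP
    simp only [paired_pairEquiv] at hlaw
    have hsum : Tendsto (fun n => sumLaw fun p => pairDevianceLaw fun _ => ν n p * M n) l
        (nhds (sumLaw fun _ => sqGaussian)) :=
      (continuous_sumLaw.tendsto _).comp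
        (tendsto_pi_nhds.2 fun p => tendsto_pairDevianceLaw.comp (hlim p))
    refine ⟨fun n => (hlaw n).aemeasurable, aemeasurable_id, ?_⟩
    simpa only [(hlaw _).map_eq, Measure.map_id, ← sumLaw_sqGaussian] using! hsum
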